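/- Let $\mathbb N=\{1,2,3,\dots\}$. For a set $X$ let $\mathcal P_f(X)$ be the set of nonempty finite subsets of $X$, and let ${}^{\mathbb N}\mathbb N$ be the set of all functions $\mathbb N\to\mathbb N$. For nonempty finite sets $\beta,\gamma$ of positive integers write $\beta<\gamma$ if $\max\beta<\min\gamma$. Let $\beta\mathbb N$ be the set of ultrafilters on $\mathbb N$, with the addition given by $A\in p+q$ if and only if $\{x\in\mathbb N:\{y\in\mathbb N: x+y\in A\}\in q\}\in p$. A set $A\subseteq\mathbb N$ is a $J$-set if for every $F\in\mathcal P_f({}^{\mathbb N}\mathbb N)$ there are $a\in\mathbb N$ and $\beta\in\mathcal P_f(\mathbb N)$ such that $a+\sum_{t\in\beta}f(t)\in A$ for all $f\in F$; and $\mathcal J=\{p\in\beta\mathbb N:\text{every }A\in p\text{ is a }J\text{-set}\}$. For $p_1,p_2,\dots\in\beta\mathbb N$ the ultrafilter $\bigotimes_{i=1}^{k}p_i$ on $\mathbb N^k$ is defined by $\bigotimes_{i=1}^1p_i=p_1$ and, for $A\subseteq\mathbb N^{k+1}$, $A\in\bigotimes_{i=1}^{k+1}p_i$ if and only if $$\bigl\{(x_1,\dots,x_k)\in\mathbb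 N^k:\{x_{k+1}\in\mathbb N:(x_1,\dots,x_{k+1})\in A\}\in p_{k+1}\bigr\}\in\bigotimes_{i=1}^{k}p_i .$$ **Theorem (Multidimensional Stronger Central Sets Theorem II).** Let $m\in\mathbb N$ and $A\subseteq\mathbb N^m$. The following two statements are equivalent. (1) There exist functions $\alpha_1,\dots,\alpha_m:\mathcal P_f({}^{\mathbb N}\mathbb N)\to\mathbb N$ and $H_1,\dots,H_m:\mathcal P_f({}^{\mathbb N}\mathbb N)\to\mathcal P_f(\mathbb N)$ such that (a) if $F,G\in\mathcal P_f({}^{\mathbb N}\mathbb N)$ and $F\subsetneq G$, then $\max H_j(F)<\min H_j(G)$ for every $j\in\{1,\dots,m\}$; and (b) whenever $n\ge m$ is an integer, $G_1\subsetneq G_2\subsetneq\dots\subsetneq G_n$ are in $\mathcal P_f({}^{\mathbb N}\mathbb N)$, $\beta_1<\beta_2<\dots<\beta_m$ are nonempty subsets of $\{1,\dots,n\}$, and $f_i\in G_i$ for every $i\in\{1,\dots,n\}$, one has $$\left(\sum_{i\in\beta_1}\Bigl(\alpha_1(G_i)+\sum_{t\in H_1(G_i)}f_i(t)\Bigr),\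 \dots,\ \sum_{i\in\beta_m}\Bigl(\alpha_m(G_i)+\sum_{t\in H_m(G_i)}f_i(t)\Bigr)\right)\in A .$$ (2) There exist $p_1,\dots,p_m\in\mathcal J$ with $p_j+p_j=p_j$ for every $j\in\{1,\dots,m\}$, such that $A\in\bigotimes_{i=1}^m p_i$. -/

import Mathlib

-- Mathlib's addition of ultrafilters: `A ∈ p + q ↔ {x | {y | x + y ∈ A} ∈ q} ∈ p`.
attribute [local instance] Ultrafilter.add

namespace CentralSets

/-- `𝒫_f(X)`: the nonempty finite subsets of `X`. -/
abbrev Pf (X : Type*) : Type _ := {s : Finset X // s.Nonempty}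

/-- The sum `∑ i ∈ s, g i` of positive integers over a nonempty finite set,
as a positive integer. -/
def pfSum {ι : Type*} (s : Pf ι) (g : ι → ℕ+) : ℕ+ :=
  ⟨∑ i ∈ s.1, (g i : ℕ), Finset.sum_pos (fun i _ => (g i).pos) s.2⟩

theorem coe_pfSum {ι : Type*} (s : Pf ι) (g : ι → ℕ+) :
    ((pfSum s g : ℕ+) : ℕ) = ∑ i ∈ s.1, (g i : ℕ) := rfl

/-- `s < t` for nonempty finite sets of a linear order: `max s < min t`. -/
def Before {ι : Type*} [LinearOrder ι] (s t : Pf ι) : Prop :=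
  s.1.max' s.2 < t.1.min' t.2

/-- `J`-sets of positive integers. -/
def IsJSet (A : Set ℕ+) : Prop :=
  ∀ F : Pf (ℕ+ → ℕ+), ∃ (a : ℕ+) (b : Pf ℕ+), ∀ f ∈ F.1, a + pfSum b f ∈ A

/-- The set `𝒥 ⊆ βℕ` of ultrafilters all of whose members are `J`-sets. -/
def J : Set (Ultrafilter ℕ+) := {p | ∀ A ∈ p, IsJSet A}

theorem mem_ultrafilter_add (p q : Ultrafilter ℕ+) (A : Set ℕ+) :
    A ∈ p + q ↔ {x : ℕ+ | {y : ℕ+ | x + y ∈ A} ∈ q} ∈ p := Iff.rfl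

/-- The tensor product `p₁ ⊗ ⋯ ⊗ p_k`, an ultrafilter on `X ^ k`, by recursion on `k`;
`mem_tensor_one` and `mem_tensor_succ` below are the usual recursive description. -/
def tensor {X : Type*} : (k : ℕ) → (Fin k → Ultrafilter X) → Ultrafilter (Fin k → X)
  | 0, _ => pure Fin.elim0
  | k + 1, p =>
      (tensor k (Fin.init p)).bind fun x =>
        (p (Fin.last k)).map fun y => (Fin.snoc x y : Fin (k + 1) → X)

theorem mem_tensor_succ {X : Type*} (k : ℕ) (p : Fin (k + 1) → Ultrafilter X)
    (A : Set (Fin (k + 1) → X)) :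
    A ∈ tensor (k + 1) p ↔
      {x : Fin k → X | {y : X | (Fin.snoc x y : Fin (k + 1) → X) ∈ A} ∈ p (Fin.last k)} ∈
        tensor k (Fin.init p) := Iff.rfl

theorem mem_tensor_one {X : Type*} (p : Fin 1 → Ultrafilter X) (A : Set (Fin 1 → X)) :
    A ∈ tensor 1 p ↔ {y : X | (fun _ => y) ∈ A} ∈ p 0 := by
  have h : ∀ y : X, (Fin.snoc (Fin.elim0 : Fin 0 → X) y : Fin 1 → X) = fun _ => y := by
    intro y
    funext i
    fin_cases i
    rfl
  rw [mem_tensor_succ]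
  change _ ∈ (pure Fin.elim0 : Ultrafilter (Fin 0 → X)) ↔ _
  rw [Ultrafilter.mem_pure]
  simp only [Set.mem_ofPred_eq, h]
  rfl

end CentralSets

open CentralSets

namespace CentralSets

open Filter

/-! ### J-sets -/

/-! From functions to ultrafilters: for fixed `j`, the sums along chains above a finite set `F` form
a `J`-set that shrinks as `F` grows. Partition regularity of `J`-sets (via Hales–Jewett) and
compactness put all these sets into a common member of `J`. Such members form a compact semigroup
because chains concatenate, so there is an idempotent `p j` among them. Since `p j` sees chains
above every `F`, the chain for coordinate `j` can start above those already used, which puts `A` in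
the tensor product.

From ultrafilters to functions: unfold `A ∈ tensor m p` into a tree and track states recording how
many blocks have begun and their partial sums. Idempotence makes almost every increment keep a state
extendable. Only finitely many states arise below a finite `F`, so one `p j`-large set of increments
serves them all. It is a `J`-set, hence supplies the values of `α j` and `H j` at `F`; recursion on
strict inclusion does the rest. -/

theorem IsJSet.mono {A B : Set ℕ+} (hA : IsJSet A) (h : A ⊆ B) : IsJSet B := fun F => by
  obtain ⟨a, b, hab⟩ := hA F
  exact ⟨a, b, fun f hf => h (hab f hf)⟩

theorem not_isJSet_empty : ¬ IsJSet ∅ := fun h => by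
  obtain ⟨a, b, hab⟩ := h ⟨{fun _ => 1}, by simp⟩
  exact hab _ (Finset.mem_singleton_self _)

/-- The summation set witnessing the `J`-set property can be chosen beyond any bound. -/
theorem IsJSet.exists_gt {A : Set ℕ+} (hA : IsJSet A) (r : ℕ+) (F : Pf (ℕ+ → ℕ+)) :
    ∃ (a : ℕ+) (b : Pf ℕ+), (∀ t ∈ b.1, r < t) ∧ ∀ f ∈ F.1, a + pfSum b f ∈ A := by
  classical
  obtain ⟨a, b, hab⟩ := hA ⟨F.1.image fun f t => f (r + t), F.2.image _⟩
  refine ⟨a, ⟨b.1.map (addLeftEmbedding r), b.2.map⟩, ?_, fun f hf => ?_⟩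
  · intro t ht
    obtain ⟨s, -, rfl⟩ := Finset.mem_map.1 ht
    exact PNat.lt_add_right r s
  · have h := hab _ (Finset.mem_image_of_mem (fun f t => f (r + t)) hf)
    convert h using 2
    apply PNat.coe_injective
    simp [coe_pfSum]

/-- `J`-sets are partition regular. -/
theorem IsJSet.or_of_union {A B : Set ℕ+} (h : IsJSet (A ∪ B)) : IsJSet A ∨ IsJSet B := by
  classical
  by_contra! hAB
  obtain ⟨hA, hB⟩ := hAB
  unfold IsJSet at hA hB
  push Not at hA hB
  obtain ⟨F₁, h₁⟩ := hA
  obtain ⟨F₂, h₂⟩ := hB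
  let F : Finset (ℕ+ → ℕ+) := F₁.1 ∪ F₂.1
  obtain ⟨f₀, hf₀⟩ := F₁.2
  have hF₀ : f₀ ∈ F := Finset.mem_union_left _ hf₀
  -- Hales–Jewett with alphabet `F`; a word is coloured by whether its sum falls in `A`.
  obtain ⟨ι, _, hι⟩ := Combinatorics.Line.exists_mono_in_high_dimension F Prop
  have hne : (Finset.univ : Finset ι).Nonempty := by
    obtain ⟨l, -⟩ := hι fun _ => True
    exact ⟨l.proper.choose, Finset.mem_univ _⟩
  obtain ⟨e, he⟩ := exists_injective_nat (ℕ+ × ι)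
  let pos : ℕ+ × ι → ℕ+ := fun q => (e q).succPNat
  have hpos : pos.Injective := fun q q' h => he (Nat.succPNat_injective h)
  -- Each pair `(t, i)` has its own position, so on a line the moving coordinates sum `f` over a set
  -- `b'` independent of `f`, and the fixed ones go into the constant `a'`.
  let g : (ι → F) → ℕ+ → ℕ+ := fun w t => pfSum ⟨Finset.univ, hne⟩ fun i => (w i).1 (pos (t, i))
  obtain ⟨a, b, hab⟩ := h ⟨Finset.univ.image g, ⟨_, Finset.mem_image_of_mem g
    (Finset.mem_univ fun _ => ⟨f₀, hF₀⟩)⟩⟩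
  obtain ⟨l, c, hl⟩ := hι fun w => a + pfSum b (g w) ∈ A
  let V : Finset ι := {i | l.idxFun i = none}
  have hV : V.Nonempty := by
    obtain ⟨i, hi⟩ := l.proper
    exact ⟨i, by simp [V, hi]⟩
  let b' : Pf ℕ+ := ⟨(b.1 ×ˢ V).image pos, (b.2.product hV).image _⟩
  obtain ⟨a', ha'⟩ : ∃ a' : ℕ+, (a' : ℕ) = a + ∑ t ∈ b.1, ∑ i with ¬ l.idxFun i = none,
      ((((l.idxFun i).getD ⟨f₀, hF₀⟩).1 (pos (t, i)) : ℕ+) : ℕ) :=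
    ⟨⟨_, by positivity⟩, rfl⟩
  have key : ∀ f : F, a' + pfSum b' f.1 = a + pfSum b (g (l f)) := by
    intro f
    apply PNat.coe_injective
    simp only [PNat.add_coe, coe_pfSum, ha', b', g]
    rw [Finset.sum_image hpos.injOn, Finset.sum_product, add_assoc, ← Finset.sum_add_distrib]
    congr 1
    refine Finset.sum_congr rfl fun t _ => ?_
    rw [← Finset.sum_filter_add_sum_filter_not Finset.univ (fun i => l.idxFun i = none), add_comm]
    congr 1
    · refine Finset.sum_congr rfl fun i hi => ?_
      rw [l.apply_none _ _ (Finset.mem_filter.1 hi).2]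
    · refine Finset.sum_congr rfl fun i hi => ?_
      obtain ⟨y, hy⟩ := Option.ne_none_iff_exists'.1 (Finset.mem_filter.1 hi).2
      rw [l.apply_some hy, hy, Option.getD_some]
  have hlA : ∀ f : F, (a' + pfSum b' f.1 ∈ A) = c := fun f => by rw [key]; exact hl f
  by_cases hc : c
  · obtain ⟨f, hf, hfA⟩ := h₁ a' b'
    exact hfA ((hlA ⟨f, Finset.mem_union_left _ hf⟩).mpr hc)
  · obtain ⟨f, hf, hfB⟩ := h₂ a' b'
    let f' : F := ⟨f, Finset.mem_union_right _ hf⟩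
    have h' := hab _ (Finset.mem_image_of_mem g (Finset.mem_univ (l f')))
    rw [← key] at h'
    exact h'.elim (fun hA => hc ((hlA f').mp hA)) hfB

/-- Every `J`-set belongs to an ultrafilter consisting of `J`-sets. -/
theorem IsJSet.exists_mem_J {A : Set ℕ+} (hA : IsJSet A) : ∃ p ∈ J, A ∈ p := by
  -- Sets negligible in `A` are those meeting it in a non-`J`-set; any ultrafilter refining the dual
  -- filter works.
  let l : Filter ℕ+ :=
    { sets := {B | ¬ IsJSet (A \ B)}
      univ_sets := by simpa using not_isJSet_empty
      sets_of_superset := fun hB hBC h => hB (h.mono (Set.sdiff_subset_sdiff_right hBC))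
      inter_sets := fun {B C} hB hC h => by
        have h' : IsJSet (A \ B ∪ A \ C) := by rwa [← Set.sdiff_inter]
        exact h'.or_of_union.elim hB hC }
  have hl : l.NeBot := ⟨fun h => by
    have : (∅ : Set ℕ+) ∈ l := h ▸ Filter.mem_bot
    exact this (by simpa using hA)⟩
  refine ⟨Ultrafilter.of l, fun B hB => ?_, Ultrafilter.of_le l ?_⟩
  · by_contra hB'
    have : Bᶜ ∈ l := fun h => hB' (h.mono (by simp))
    exact Ultrafilter.compl_notMem_iff.2 hB (Ultrafilter.of_le l this)
  · change ¬ IsJSet (A \ A)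
    simpa using not_isJSet_empty

theorem isClosed_J : IsClosed J := by
  have : J = ⋂ A ∈ {A : Set ℕ+ | ¬ IsJSet A}, {p : Ultrafilter ℕ+ | Aᶜ ∈ p} := by
    ext p
    simp only [J, Set.mem_iInter, Set.mem_ofPred_eq, Ultrafilter.compl_mem_iff_notMem]
    exact forall_congr' fun A => not_imp_not.symm
  rw [this]
  exact isClosed_biInter fun A _ => ultrafilter_isClosed_basic _

/-- Finitely many `q`-large conditions have a common solution `y`, which is absorbed into the
constant `a`. -/
theorem add_mem_J {p : Ultrafilter ℕ+} (hp : p ∈ J) (q : Ultrafilter ℕ+) : p + q ∈ J := by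
  intro A hA F
  obtain ⟨a, b, hab⟩ := hp _ hA F
  have : ∀ᶠ y in (q : Filter ℕ+), ∀ f ∈ F.1, a + pfSum b f + y ∈ A :=
    (Finset.eventually_all F.1).2 hab
  obtain ⟨y, hy⟩ := this.exists
  exact ⟨a + y, b, fun f hf => by simpa only [add_right_comm] using hy f hf⟩

/-- For an idempotent `p` and `B ∈ p`, the translates of `B` by `p`-almost every element of `B`
lie in `p`, and this persists after translation. -/
theorem eventually_add_of_idempotent {p : Ultrafilter ℕ+} (hp : p + p = p) {B : ℕ+ → Prop}
    (hB : ∀ᶠ y in (p : Filter ℕ+), B y) :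
    ∀ᶠ y in (p : Filter ℕ+), ∀ᶠ z in (p : Filter ℕ+), B (y + z) := by
  rw [← hp] at hB
  exact hB

/-! ### Sums along chains -/

/-- `ChainSum a H F x G`: the element `x` is a sum of terms `a Gᵢ + ∑ t ∈ H Gᵢ, fᵢ t` with
`fᵢ ∈ Gᵢ` along a nonempty strictly increasing chain above `F` whose last member is `G`. -/
inductive ChainSum (a : Pf (ℕ+ → ℕ+) → ℕ+) (H : Pf (ℕ+ → ℕ+) → Pf ℕ+) (F : Pf (ℕ+ → ℕ+)) :
    ℕ+ → Pf (ℕ+ → ℕ+) → Prop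
  | single {G : Pf (ℕ+ → ℕ+)} {f : ℕ+ → ℕ+} (hG : F.1 ⊂ G.1) (hf : f ∈ G.1) :
      ChainSum a H F (a G + pfSum (H G) f) G
  | snoc {x : ℕ+} {G G' : Pf (ℕ+ → ℕ+)} {f : ℕ+ → ℕ+} (h : ChainSum a H F x G)
      (hG : G.1 ⊂ G'.1) (hf : f ∈ G'.1) : ChainSum a H F (x + (a G' + pfSum (H G') f)) G'

/-- The sums along chains above `F`. -/
def chainSums (a : Pf (ℕ+ → ℕ+) → ℕ+) (H : Pf (ℕ+ → ℕ+) → Pf ℕ+) (F : Pf (ℕ+ → ℕ+)) : Set ℕ+ :=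
  {x | ∃ G, ChainSum a H F x G}

section

variable {a : Pf (ℕ+ → ℕ+) → ℕ+} {H : Pf (ℕ+ → ℕ+) → Pf ℕ+}

theorem ChainSum.trans {F G G' : Pf (ℕ+ → ℕ+)} {x y : ℕ+} (h : ChainSum a H F x G)
    (h' : ChainSum a H G y G') : ChainSum a H F (x + y) G' := by
  induction h' with
  | single hG hf => exact h.snoc hG hf
  | snoc _ hG hf ih => rw [← add_assoc]; exact ih.snoc hG hf

theorem ChainSum.mono {F F' G : Pf (ℕ+ → ℕ+)} {x : ℕ+} (hF : F.1 ⊆ F'.1)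
    (h : ChainSum a H F' x G) : ChainSum a H F x G := by
  induction h with
  | single hG hf => exact .single (hF.trans_ssubset hG) hf
  | snoc _ hG hf ih => exact ih.snoc hG hf

theorem chainSums_anti {F F' : Pf (ℕ+ → ℕ+)} (hF : F.1 ⊆ F'.1) :
    chainSums a H F' ⊆ chainSums a H F := fun _ ⟨G, h⟩ => ⟨G, h.mono hF⟩

theorem exists_ssubset (F : Finset (ℕ+ → ℕ+)) : ∃ G, F ⊂ G := by
  obtain ⟨f, hf⟩ := Infinite.exists_notMem_finset F
  exact ⟨_, Finset.ssubset_cons hf⟩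

theorem isJSet_chainSums (F : Pf (ℕ+ → ℕ+)) : IsJSet (chainSums a H F) := by
  classical
  intro F'
  obtain ⟨G, hG⟩ := exists_ssubset (F.1 ∪ F'.1)
  have hne : G.Nonempty := F.2.mono (Finset.subset_union_left.trans hG.1)
  exact ⟨a ⟨G, hne⟩, H ⟨G, hne⟩, fun f hf => ⟨⟨G, hne⟩, .single
    (Finset.subset_union_left.trans_ssubset hG) (hG.1 (Finset.mem_union_right _ hf))⟩⟩

theorem exists_idempotent_chainSums (a : Pf (ℕ+ → ℕ+) → ℕ+) (H : Pf (ℕ+ → ℕ+) → Pf ℕ+) :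
    ∃ p ∈ J, p + p = p ∧ ∀ F, chainSums a H F ∈ p := by
  classical
  let K : Pf (ℕ+ → ℕ+) → Set (Ultrafilter ℕ+) := fun F => J ∩ {p | chainSums a H F ∈ p}
  have hK : ∀ F, IsClosed (K F) := fun F => isClosed_J.inter (ultrafilter_isClosed_basic _)
  have : Nonempty (Pf (ℕ+ → ℕ+)) := ⟨{fun _ => 1}, by simp⟩
  have hne : (⋂ F, K F).Nonempty := by
    refine IsCompact.nonempty_iInter_of_directed_nonempty_isCompact_isClosed K ?_
      (fun F => (isJSet_chainSums F).exists_mem_J) (fun F => (hK F).isCompact) hK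
    intro F F'
    exact ⟨⟨F.1 ∪ F'.1, F.2.mono Finset.subset_union_left⟩,
      fun p hp => ⟨hp.1, mem_of_superset hp.2 (chainSums_anti Finset.subset_union_left)⟩,
      fun p hp => ⟨hp.1, mem_of_superset hp.2 (chainSums_anti Finset.subset_union_right)⟩⟩
  let := Ultrafilter.addSemigroup (M := ℕ+)
  obtain ⟨p, hp, hpp⟩ := exists_idempotent_in_compact_add_subsemigroup
    (Ultrafilter.continuous_add_left (M := ℕ+)) (⋂ F, K F) hne (isClosed_iInter hK).isCompact
    (fun p hp q hq => by
      rw [Set.mem_iInter] at hp hq ⊢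
      refine fun F => ⟨add_mem_J (hp F).1 q, ?_⟩
      -- If the chain for `x` ends at `G`, then `q` contains the sums of chains above `G`, which may
      -- be appended to it.
      refine mem_of_superset (hp F).2 ?_
      rintro x ⟨G, hG⟩
      exact mem_of_superset (hq G).2 fun y ⟨G', hG'⟩ => ⟨G', hG.trans hG'⟩)
  rw [Set.mem_iInter] at hp
  exact ⟨p, (hp (Classical.arbitrary _)).1, hpp, fun F => (hp F).2⟩

end

/-! ### Block sums along a labelled chain -/

/-- `Represents a H k X E`: for a finite strictly increasing chain of sets contained in `E`, with
a monotone labelling of its members by labels less than `k`, the number `X j` is the sum of the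
terms given by `a j` and `H j` over the members labelled `j`. -/
def Represents (a : ℕ → Pf (ℕ+ → ℕ+) → ℕ+) (H : ℕ → Pf (ℕ+ → ℕ+) → Pf ℕ+) (k : ℕ) (X : ℕ → ℕ)
    (E : Pf (ℕ+ → ℕ+)) : Prop :=
  ∃ (n : ℕ) (G : ℕ → Pf (ℕ+ → ℕ+)) (f : ℕ → ℕ+ → ℕ+) (c : ℕ → ℕ),
    (∀ i < n, f i ∈ (G i).1) ∧ (∀ i i', i < i' → i' < n → (G i).1 ⊂ (G i').1) ∧
    (∀ i < n, (G i).1 ⊆ E.1) ∧ (∀ i < n, c i < k) ∧ (∀ i i', i < i' → i' < n → c i ≤ c i') ∧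
    ∀ j, X j = ∑ i ∈ Finset.range n,
      if c i = j then ((a j (G i) + pfSum (H j (G i)) (f i) : ℕ+) : ℕ) else 0

section

variable {a : ℕ → Pf (ℕ+ → ℕ+) → ℕ+} {H : ℕ → Pf (ℕ+ → ℕ+) → Pf ℕ+}

theorem Represents.append {k l : ℕ} {X : ℕ → ℕ} {E G' : Pf (ℕ+ → ℕ+)} {f' : ℕ+ → ℕ+}
    (h : Represents a H k X E) (hG' : E.1 ⊂ G'.1) (hf' : f' ∈ G'.1) (hkl : k ≤ l + 1) :
    Represents a H (l + 1) (X + Pi.single l ((a l G' + pfSum (H l G') f' : ℕ+) : ℕ)) G' := by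
  obtain ⟨n, G, f, c, hf, hG, hE, hck, hc, hX⟩ := h
  have hlt : ∀ {i}, i < n + 1 → i ≠ n → i < n := fun h h' => by omega
  refine ⟨n + 1, Function.update G n G', Function.update f n f', Function.update c n l,
    ?_, ?_, ?_, ?_, ?_, ?_⟩
  · intro i hi
    obtain rfl | hin := eq_or_ne i n
    · simpa using hf'
    · simpa [hin] using hf i (hlt hi hin)
  · intro i i' hii hi'
    have hin : i ≠ n := by omega
    obtain rfl | hin' := eq_or_ne i' n
    · simpa [hin] using (hE i hii).trans_ssubset hG'
    · simpa [hin, hin'] using hG i i' hii (hlt hi' hin')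
  · intro i hi
    obtain rfl | hin := eq_or_ne i n
    · simp
    · simpa [hin] using (hE i (hlt hi hin)).trans hG'.1
  · intro i hi
    obtain rfl | hin := eq_or_ne i n
    · simp
    · simpa [hin] using (hck i (hlt hi hin)).trans_le hkl
  · intro i i' hii hi'
    have hin : i ≠ n := by omega
    obtain rfl | hin' := eq_or_ne i' n
    · simpa [hin] using Nat.le_of_lt_succ ((hck i hii).trans_le hkl)
    · simpa [hin, hin'] using hc i i' hii (hlt hi' hin')
  · intro j
    rw [Finset.sum_range_succ, Pi.add_apply, hX j]
    congr 1
    · refine Finset.sum_congr rfl fun i hi => ?_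
      have hin : i ≠ n := (Finset.mem_range.1 hi).ne
      simp [hin]
    · obtain rfl | hj := eq_or_ne j l
      · simp
      · simp [hj, hj.symm]

theorem Represents.chainSum {k : ℕ} {X : ℕ → ℕ} {E G : Pf (ℕ+ → ℕ+)} {y : ℕ+}
    (h : Represents a H k X E) (hy : ChainSum (a k) (H k) E y G) :
    Represents a H (k + 1) (X + Pi.single k (y : ℕ)) G := by
  induction hy with
  | single hG hf => exact h.append hG hf k.le_succ
  | snoc _ hG hf ih =>
    rw [PNat.add_coe, Pi.single_add, ← add_assoc]
    exact ih.append hG hf le_rfl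

/-- Extension of a tuple of positive integers by zeros. -/
def extendZero {k : ℕ} (x : Fin k → ℕ+) (j : ℕ) : ℕ := if h : j < k then x ⟨j, h⟩ else 0

theorem extendZero_snoc {k : ℕ} (x : Fin k → ℕ+) (y : ℕ+) :
    extendZero (Fin.snoc x y : Fin (k + 1) → ℕ+) = extendZero x + Pi.single k (y : ℕ) := by
  funext j
  obtain hj | rfl | hj := lt_trichotomy j k
  · simp [extendZero, Fin.snoc, hj, hj.ne, hj.trans k.lt_succ_self]
  · simp [extendZero, Fin.snoc]
  · simp [extendZero, hj.ne', hj.not_gt, Nat.not_lt.2 (Nat.succ_le_of_lt hj)]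

/-- Once the first `k` coordinates are represented inside `E`, the next ultrafilter contains the
chain sums above `E`, so the labelled chain continues. -/
theorem represents_mem_tensor (k : ℕ) (p : Fin k → Ultrafilter ℕ+)
    (hp : ∀ (j : Fin k) F, chainSums (a j) (H j) F ∈ p j) :
    {x | ∃ E, Represents a H k (extendZero x) E} ∈ tensor k p := by
  induction k with
  | zero =>
    change Fin.elim0 ∈ {x | ∃ E, Represents a H 0 (extendZero x) E}
    refine ⟨⟨{fun _ => 1}, by simp⟩, 0, fun _ => ⟨{fun _ => 1}, by simp⟩, fun _ _ => 1,
      fun _ => 0, ?_⟩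
    simp [extendZero]
  | succ k ih =>
    rw [mem_tensor_succ]
    refine mem_of_superset (ih (Fin.init p) fun j F => hp j.castSucc F) ?_
    rintro x ⟨E, hE⟩
    refine mem_of_superset (hp (Fin.last k) E) ?_
    rintro y ⟨G, hG⟩
    exact ⟨G, by rw [extendZero_snoc]; exact hE.chainSum hG⟩

end

theorem exists_tensor_of_chains {m : ℕ} {A : Set (Fin m → ℕ+)}
    (α : Fin m → Pf (ℕ+ → ℕ+) → ℕ+) (H : Fin m → Pf (ℕ+ → ℕ+) → Pf ℕ+)
    (hA : ∀ n : ℕ, m ≤ n →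
      ∀ G : Fin n → Pf (ℕ+ → ℕ+), (∀ i i' : Fin n, i < i' → (G i).1 ⊂ (G i').1) →
      ∀ β : Fin m → Pf (Fin n), (∀ j j' : Fin m, j < j' → Before (β j) (β j')) →
      ∀ f : Fin n → (ℕ+ → ℕ+), (∀ i : Fin n, f i ∈ (G i).1) →
        (fun j : Fin m => pfSum (β j) fun i => α j (G i) + pfSum (H j (G i)) (f i)) ∈ A) :
    ∃ p : Fin m → Ultrafilter ℕ+, (∀ j : Fin m, p j ∈ J ∧ p j + p j = p j) ∧ A ∈ tensor m p := by
  choose p hpJ hpp hp using fun j => exists_idempotent_chainSums (α j) (H j)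
  refine ⟨p, fun j => ⟨hpJ j, hpp j⟩, ?_⟩
  let α' : ℕ → Pf (ℕ+ → ℕ+) → ℕ+ := fun j => if h : j < m then α ⟨j, h⟩ else fun _ => 1
  let H' : ℕ → Pf (ℕ+ → ℕ+) → Pf ℕ+ := fun j =>
    if h : j < m then H ⟨j, h⟩ else fun _ => ⟨{1}, by simp⟩
  have hα : ∀ j : Fin m, α' j = α j := fun j => by simp [α']
  have hH : ∀ j : Fin m, H' j = H j := fun j => by simp [H']
  refine mem_of_superset (represents_mem_tensor (a := α') (H := H') m p fun j F => by
    rw [hα, hH]; exact hp j F) ?_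
  rintro x ⟨E, n, G, f, c, hf, hG, -, hcm, hc, hX⟩
  have hx : ∀ j : Fin m, (x j : ℕ) = ∑ i ∈ ({i : Fin n | c i = j} : Finset (Fin n)),
      ((α j (G i) + pfSum (H j (G i)) (f i) : ℕ+) : ℕ) := by
    intro j
    have h := hX j
    rw [hα, hH, ← Fin.sum_univ_eq_sum_range
      (fun i => if c i = j then ((α j (G i) + pfSum (H j (G i)) (f i) : ℕ+) : ℕ) else 0)] at h
    rw [Finset.sum_filter, ← h]
    simp [extendZero]
  -- The blocks are the fibres of the labelling; an empty fibre would force the positive number `x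
  -- j` to be zero.
  have hne : ∀ j : Fin m, ({i : Fin n | c i = j} : Finset (Fin n)).Nonempty := by
    intro j
    by_contra h
    have := hx j
    rw [Finset.not_nonempty_iff_eq_empty.1 h, Finset.sum_empty] at this
    exact (x j).ne_zero this
  have hmn : m ≤ n := by
    choose i hi using hne
    have hinj : Function.Injective i := fun j j' h => by
      have h₁ := (Finset.mem_filter.1 (hi j)).2
      have h₂ := (Finset.mem_filter.1 (hi j')).2
      rw [h] at h₁
      exact Fin.ext (h₁.symm.trans h₂)
    simpa using Fintype.card_le_of_injective i hinj
  have := hA n hmn (fun i => G i) (fun i i' h => hG i i' h i'.2)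
    (fun j => ⟨({i : Fin n | c i = j} : Finset (Fin n)), hne j⟩) ?_ (fun i => f i)
    (fun i => hf i i.2)
  · convert this using 1
    funext j
    apply PNat.coe_injective
    rw [hx, coe_pfSum]
  · intro j j' hjj
    unfold Before
    rw [Finset.max'_lt_iff]
    intro i hi
    rw [Finset.lt_min'_iff]
    intro i' hi'
    have h₁ := (Finset.mem_filter.1 hi).2
    have h₂ := (Finset.mem_filter.1 hi').2
    by_contra! h
    have hjj' : (j : ℕ) < j' := hjj
    obtain h | h := h.lt_or_eq
    · have := hc i' i h i.2
      omega
    · subst h; omega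

/-! ### Trees of initial segments -/

/-- Membership in a tensor product, unfolded into sets `L k` of sequences whose first `k` entries
are admissible initial segments. -/
theorem exists_tree_of_mem_tensor (m : ℕ) (p : Fin m → Ultrafilter ℕ+) (A : Set (Fin m → ℕ+))
    (hA : A ∈ tensor m p) :
    ∃ L : ℕ → Set (ℕ → ℕ+), (∀ x, x ∈ L 0) ∧
      (∀ (j : Fin m), ∀ x ∈ L j, ∀ᶠ y in (p j : Filter ℕ+), Function.update x j y ∈ L (j + 1)) ∧
      ∀ x ∈ L m, (fun i : Fin m => x i) ∈ A := by
  induction m with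
  | zero =>
    refine ⟨fun _ => Set.univ, fun _ => trivial, fun j => j.elim0, fun x _ => ?_⟩
    have h : Fin.elim0 ∈ A := hA
    convert h
  | succ m ih =>
    obtain ⟨L, h0, hL, hm⟩ := ih _ _ ((mem_tensor_succ m p A).1 hA)
    refine ⟨Function.update L (m + 1) {x | (fun i : Fin (m + 1) => x i) ∈ A}, ?_, ?_, ?_⟩
    · simpa using h0
    · intro j x hx
      have hj : (j : ℕ) ≠ m + 1 := j.2.ne
      rw [Function.update_of_ne hj] at hx
      obtain ⟨i, rfl⟩ | rfl := j.eq_castSucc_or_eq_last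
      · have hi : (i.castSucc : ℕ) + 1 ≠ m + 1 := by simpa using i.2.ne
        rw [Function.update_of_ne hi]
        exact hL i x hx
      · refine mem_of_superset (hm x hx) fun y hy => ?_
        simp only [Fin.val_last, Function.update_self, Set.mem_ofPred_eq] at hy ⊢
        convert hy using 1
        funext i
        obtain ⟨i, rfl⟩ | rfl := i.eq_castSucc_or_eq_last
        · simp [i.2.ne]
        · simp
    · intro x hx
      simpa using hx

/-- A state `(k, x)`: the first `k` entries of `x` have been started. It is admissible when it lies
in the tree and its last started entry can still be increased. -/
def Admissible {m : ℕ} (p : Fin m → Ultrafilter ℕ+) (L : ℕ → Set (ℕ → ℕ+))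
    (s : ℕ × (ℕ → ℕ+)) : Prop :=
  s.1 ≤ m ∧ s.2 ∈ L s.1 ∧ ∀ j : Fin m, s.1 = j + 1 →
    ∀ᶠ y in (p j : Filter ℕ+), Function.update s.2 j (s.2 j + y) ∈ L (j + 1)

/-- Add `y` to the entry `j` of a state, starting that entry if necessary. -/
def extendState (s : ℕ × (ℕ → ℕ+)) (j : ℕ) (y : ℕ+) : ℕ × (ℕ → ℕ+) :=
  (j + 1, Function.update s.2 j (if s.1 = j then y else s.2 j + y))

/-- Idempotence gives, for almost every `y`, room for almost every further increment `z`: the last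
clause of admissibility for the new state. -/
theorem Admissible.eventually_extendState {m : ℕ} {p : Fin m → Ultrafilter ℕ+}
    (hp : ∀ j, p j + p j = p j) {L : ℕ → Set (ℕ → ℕ+)}
    (hL : ∀ (j : Fin m), ∀ x ∈ L j,
      ∀ᶠ y in (p j : Filter ℕ+), Function.update x j y ∈ L (j + 1))
    {s : ℕ × (ℕ → ℕ+)} (hs : Admissible p L s) (j : Fin m) (hj : s.1 = j ∨ s.1 = j + 1) :
    ∀ᶠ y in (p j : Filter ℕ+), Admissible p L (extendState s j y) := by
  have h : ∀ᶠ y in (p j : Filter ℕ+),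
      Function.update s.2 j (if s.1 = j then y else s.2 j + y) ∈ L (j + 1) := by
    obtain hj | hj := hj
    · simpa only [hj, if_true] using hL j s.2 (hj ▸ hs.2.1)
    · simpa [hj] using hs.2.2 j hj
  filter_upwards [h, eventually_add_of_idempotent (hp j) h] with y hy hyz
  refine ⟨j.2, hy, fun i hi => ?_⟩
  obtain rfl : j = i := Fin.ext (Nat.succ_injective hi)
  filter_upwards [hyz] with z hz
  simp only [extendState, Function.update_self, Function.update_idem]
  convert hz using 2
  split_ifs <;> simp [add_assoc]

/-! ### Recursive construction -/

/-- Choice along a well-founded relation. -/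
theorem exists_forall_of_wellFounded {X V : Type*} {r : X → X → Prop} (hr : WellFounded r)
    (P : (x : X) → ((y : X) → r y x → V) → V → Prop) (h : ∀ x g, ∃ v, P x g v) :
    ∃ c : X → V, ∀ x, P x (fun y _ => c y) (c x) := by
  choose v hv using h
  refine ⟨hr.fix v, fun x => ?_⟩
  have := hv x fun y _ => hr.fix v y
  rwa [← hr.fix_eq v x] at this

theorem finite_ssubset (F : Pf (ℕ+ → ℕ+)) : {G : Pf (ℕ+ → ℕ+) | G.1 ⊂ F.1}.Finite :=
  Set.Finite.of_finite_image
    ((Finset.finite_toSet F.1.powerset).subset (by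
      rintro _ ⟨G, hG, rfl⟩
      exact Finset.mem_coe.2 (Finset.mem_powerset.2 hG.1)))
    Subtype.val_injective.injOn

theorem exists_forall_admissible {m : ℕ} {p : Fin m → Ultrafilter ℕ+}
    (hpJ : ∀ j, p j ∈ J) (hp : ∀ j, p j + p j = p j) {L : ℕ → Set (ℕ → ℕ+)}
    (hL : ∀ (j : Fin m), ∀ x ∈ L j,
      ∀ᶠ y in (p j : Filter ℕ+), Function.update x j y ∈ L (j + 1))
    {S : Set (ℕ × (ℕ → ℕ+))} (hSfin : S.Finite) (hS : ∀ s ∈ S, Admissible p L s)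
    (r : ℕ+) (F : Pf (ℕ+ → ℕ+)) (j : Fin m) :
    ∃ (a : ℕ+) (H : Pf ℕ+), (∀ t ∈ H.1, r < t) ∧ ∀ f ∈ F.1, ∀ s ∈ S, s.1 = j ∨ s.1 = j + 1 →
      Admissible p L (extendState s j (a + pfSum H f)) := by
  have h : ∀ᶠ y in (p j : Filter ℕ+), ∀ s ∈ S, s.1 = j ∨ s.1 = j + 1 →
      Admissible p L (extendState s j y) := by
    rw [Filter.eventually_all_finite hSfin]
    intro s hs
    by_cases hj : s.1 = j ∨ s.1 = j + 1
    · filter_upwards [(hS s hs).eventually_extendState hp hL j hj] with y hy _ using hy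
    · exact .of_forall fun y h => (hj h).elim
  exact (hpJ j _ h).exists_gt r F

/-- Choices of `α`, `H` and of sets of admissible states, such that a state available strictly
below `F` may be extended by any term given by `F`. -/
theorem exists_chain_functions {m : ℕ} {p : Fin m → Ultrafilter ℕ+}
    (hpJ : ∀ j, p j ∈ J) (hp : ∀ j, p j + p j = p j) {L : ℕ → Set (ℕ → ℕ+)}
    (hL0 : ∀ x, x ∈ L 0)
    (hL : ∀ (j : Fin m), ∀ x ∈ L j,
      ∀ᶠ y in (p j : Filter ℕ+), Function.update x j y ∈ L (j + 1)) :
    ∃ (α : Fin m → Pf (ℕ+ → ℕ+) → ℕ+) (H : Fin m → Pf (ℕ+ → ℕ+) → Pf ℕ+)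
      (S : Pf (ℕ+ → ℕ+) → Set (ℕ × (ℕ → ℕ+))),
      (∀ F G : Pf (ℕ+ → ℕ+), F.1 ⊂ G.1 → ∀ j : Fin m, Before (H j F) (H j G)) ∧
      (∀ F, ∀ s ∈ S F, Admissible p L s) ∧ (∀ F, (0, fun _ => 1) ∈ S F) ∧
      ∀ F G : Pf (ℕ+ → ℕ+), F.1 ⊂ G.1 → ∀ s ∈ S F, s ∈ S G ∧
        ∀ (j : Fin m), ∀ f ∈ F.1, s.1 = j ∨ s.1 = j + 1 →
          extendState s j (α j F + pfSum (H j F) f) ∈ S G := by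
  let z : ℕ × (ℕ → ℕ+) := (0, fun _ => 1)
  have hz : Admissible p L z := ⟨Nat.zero_le _, hL0 _, fun j h => (Nat.succ_ne_zero _ h.symm).elim⟩
  let V := (Fin m → ℕ+) × (Fin m → Pf ℕ+) ×
    {T : Set (ℕ × (ℕ → ℕ+)) // T.Finite ∧ ∀ s ∈ T, Admissible p L s}
  have hwf : WellFounded fun G F : Pf (ℕ+ → ℕ+) => G.1 ⊂ F.1 :=
    InvImage.wf Subtype.val wellFounded_lt
  let P (F : Pf (ℕ+ → ℕ+)) (g : (G : Pf (ℕ+ → ℕ+)) → G.1 ⊂ F.1 → V) (v : V) : Prop :=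
    (∀ (G : Pf (ℕ+ → ℕ+)) (h : G.1 ⊂ F.1) (j : Fin m), Before ((g G h).2.1 j) (v.2.1 j)) ∧
      ∀ s, (s = z ∨ ∃ (G : Pf (ℕ+ → ℕ+)) (h : G.1 ⊂ F.1), s ∈ (g G h).2.2.1) →
        ∀ (j : Fin m), ∀ f ∈ F.1,
        s.1 = j ∨ s.1 = j + 1 → extendState s j (v.1 j + pfSum (v.2.1 j) f) ∈ v.2.2.1
  have hstep : ∀ F g, ∃ v, P F g v := by
    intro F g
    have hfin : Finite {G : Pf (ℕ+ → ℕ+) // G.1 ⊂ F.1} := (finite_ssubset F).to_subtype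
    let S : Set (ℕ × (ℕ → ℕ+)) :=
      {s | s = z ∨ ∃ (G : Pf (ℕ+ → ℕ+)) (h : G.1 ⊂ F.1), s ∈ (g G h).2.2.1}
    have hSfin : S.Finite := by
      have : (⋃ G : {G : Pf (ℕ+ → ℕ+) // G.1 ⊂ F.1}, (g G.1 G.2).2.2.1).Finite :=
        Set.finite_iUnion fun G => (g G.1 G.2).2.2.2.1
      refine (this.insert z).subset ?_
      rintro s (rfl | ⟨G, h, hs⟩)
      · exact Set.mem_insert _ _
      · exact Set.mem_insert_of_mem _ (Set.mem_iUnion.2 ⟨⟨G, h⟩, hs⟩)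
    have hS : ∀ s ∈ S, Admissible p L s := by
      rintro s (rfl | ⟨G, h, hs⟩)
      · exact hz
      · exact (g G h).2.2.2.2 s hs
    -- A bound for all summation sets chosen below `F`; placing the new ones beyond it gives the
    -- required order.
    obtain ⟨r, hr⟩ : ∃ r : ℕ+, ∀ (G : Pf (ℕ+ → ℕ+)) (h : G.1 ⊂ F.1) (j : Fin m),
        ∀ t ∈ ((g G h).2.1 j).1, t ≤ r := by
      have : (⋃ q : {G : Pf (ℕ+ → ℕ+) // G.1 ⊂ F.1} × Fin m,
          (((g q.1.1 q.1.2).2.1 q.2).1 : Set ℕ+)).Finite :=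
        Set.finite_iUnion fun q => Finset.finite_toSet _
      obtain ⟨r, hr⟩ := this.bddAbove
      exact ⟨r, fun G h j t ht => hr (Set.mem_iUnion.2 ⟨(⟨G, h⟩, j), ht⟩)⟩
    choose a H hHr haH using exists_forall_admissible hpJ hp hL hSfin hS r F
    -- The states whose last increment comes from `F`; finiteness of `S` and `F` passes to `T`, as
    -- the recursion needs.
    let T : Set (ℕ × (ℕ → ℕ+)) := {s' | Admissible p L s' ∧ ∃ s ∈ S, ∃ (j : Fin m), ∃ f ∈ F.1,
      s' = extendState s j (a j + pfSum (H j) f)}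
    have hT : T.Finite := by
      refine (Set.Finite.image (fun q : (ℕ × (ℕ → ℕ+)) × Fin m × (ℕ+ → ℕ+) =>
        extendState q.1 q.2.1 (a q.2.1 + pfSum (H q.2.1) q.2.2))
        (hSfin.prod (Set.finite_univ.prod F.1.finite_toSet))).subset ?_
      rintro _ ⟨-, s, hs, j, f, hf, rfl⟩
      exact ⟨(s, j, f), ⟨hs, trivial, hf⟩, rfl⟩
    refine ⟨(a, H, ⟨T, hT, fun s hs => hs.1⟩), fun G h j => ?_, fun s hs j f hf hj =>
      ⟨haH j f hf s hs hj, s, hs, j, f, hf, rfl⟩⟩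
    exact (hr G h j _ (Finset.max'_mem _ _)).trans_lt (hHr j _ (Finset.min'_mem _ _))
  obtain ⟨c, hc⟩ := exists_forall_of_wellFounded hwf P hstep
  refine ⟨fun j F => (c F).1 j, fun j F => (c F).2.1 j,
    fun F => {s | s = z ∨ ∃ G : Pf (ℕ+ → ℕ+), G.1 ⊂ F.1 ∧ s ∈ (c G).2.2.1},
    fun F G h j => (hc G).1 F h j, ?_, fun F => Or.inl rfl, ?_⟩
  · rintro F s (rfl | ⟨G, -, hs⟩)
    · exact hz
    · exact (c G).2.2.2.2 s hs
  · intro F G hFG s hs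
    refine ⟨hs.imp_right fun ⟨E, hE, hsE⟩ => ⟨E, hE.trans hFG, hsE⟩, fun j f hf hj =>
      Or.inr ⟨F, hFG, (hc F).2 s ?_ j f hf hj⟩⟩
    exact hs.imp_right fun ⟨E, hE, hsE⟩ => ⟨E, hE, hsE⟩

theorem exists_chains_of_tensor {m : ℕ} {A : Set (Fin m → ℕ+)} {p : Fin m → Ultrafilter ℕ+}
    (hp : ∀ j : Fin m, p j ∈ J ∧ p j + p j = p j) (hA : A ∈ tensor m p) :
    ∃ (α : Fin m → Pf (ℕ+ → ℕ+) → ℕ+) (H : Fin m → Pf (ℕ+ → ℕ+) → Pf ℕ+),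
      (∀ F G : Pf (ℕ+ → ℕ+), F.1 ⊂ G.1 → ∀ j : Fin m, Before (H j F) (H j G)) ∧
      (∀ n : ℕ, m ≤ n →
        ∀ G : Fin n → Pf (ℕ+ → ℕ+), (∀ i i' : Fin n, i < i' → (G i).1 ⊂ (G i').1) →
        ∀ β : Fin m → Pf (Fin n), (∀ j j' : Fin m, j < j' → Before (β j) (β j')) →
        ∀ f : Fin n → (ℕ+ → ℕ+), (∀ i : Fin n, f i ∈ (G i).1) →
          (fun j : Fin m => pfSum (β j) fun i => α j (G i) + pfSum (H j (G i)) (f i)) ∈ A) := by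
  obtain ⟨L, hL0, hL, hLA⟩ := exists_tree_of_mem_tensor m p A hA
  obtain ⟨α, H, S, hH, hS, hS0, hSext⟩ :=
    exists_chain_functions (fun j => (hp j).1) (fun j => (hp j).2) hL0 hL
  refine ⟨α, H, hH, fun n _ G hG β hβ f hf => ?_⟩
  have hβlt : ∀ j j' : Fin m, j < j' → ∀ i ∈ (β j).1, ∀ i' ∈ (β j').1, i < i' :=
    fun j j' h i hi i' hi' =>
      ((Finset.le_max' _ _ hi).trans_lt (hβ j j' h)).trans_le (Finset.min'_le _ _ hi')
  -- Invariant after the first `l` sets: the state counts the blocks already met and holds their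
  -- partial sums. Indices in no block leave it unchanged.
  have key : ∀ l ≤ n, ∃ s : ℕ × (ℕ → ℕ+),
      (∀ F, (∀ i : Fin n, (i : ℕ) < l → (G i).1 ⊂ F.1) → s ∈ S F) ∧
      ∀ j : Fin m, ((j : ℕ) < s.1 ↔ ∃ i ∈ (β j).1, (i : ℕ) < l) ∧
        ((j : ℕ) < s.1 → ((s.2 j : ℕ+) : ℕ) = ∑ i ∈ (β j).1.filter fun i : Fin n => (i : ℕ) < l,
          ((α j (G i) + pfSum (H j (G i)) (f i) : ℕ+) : ℕ)) := by
    intro l hl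
    induction l with
    | zero => exact ⟨(0, fun _ => 1), fun F _ => hS0 F, by simp⟩
    | succ l ih =>
      obtain ⟨⟨k, x⟩, hs, hk⟩ := ih (Nat.le_of_succ_le hl)
      dsimp only at hk
      let i₀ : Fin n := ⟨l, hl⟩
      have hfilter : ∀ j, i₀ ∉ (β j).1 → ∀ i ∈ (β j).1, (i : ℕ) < l + 1 ↔ (i : ℕ) < l := by
        intro j hj i hi
        have : (i : ℕ) ≠ l := fun h => hj (by rwa [← show i = i₀ from Fin.ext h])
        omega
      have hstay : ∀ j, i₀ ∉ (β j).1 → ((∃ i ∈ (β j).1, (i : ℕ) < l + 1) ↔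
          ∃ i ∈ (β j).1, (i : ℕ) < l) ∧
          ((β j).1.filter fun i : Fin n => (i : ℕ) < l + 1) =
            ((β j).1.filter fun i : Fin n => (i : ℕ) < l) := fun j hj =>
        ⟨exists_congr fun i => and_congr_right fun hi => hfilter j hj i hi,
          Finset.filter_congr (hfilter j hj)⟩
      by_cases hex : ∃ j, i₀ ∈ (β j).1
      · obtain ⟨j, hj⟩ := hex
        have hnot : ∀ j', j' ≠ j → i₀ ∉ (β j').1 := fun j' hj' h => by
          obtain h' | h' := hj'.lt_or_gt
          · exact (hβlt _ _ h' _ h _ hj).false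
          · exact (hβlt _ _ h' _ hj _ h).false
        have hbelow : ∀ j' : Fin m, j' < j → (j' : ℕ) < k := fun j' h => by
          obtain ⟨i, hi⟩ := (β j').2
          exact (hk j').1.2 ⟨i, hi, hβlt _ _ h i hi i₀ hj⟩
        have habove : ∀ j' : Fin m, j < j' → ¬ (j' : ℕ) < k := fun j' h h' => by
          obtain ⟨i, hi, hil⟩ := (hk j').1.1 h'
          have : i₀ < i := hβlt _ _ h i₀ hj i hi
          exact (lt_asymm this hil).elim
        have hkm : k ≤ m := by
          obtain ⟨F, hF⟩ := exists_ssubset (G i₀).1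
          exact (hS ⟨F, (G i₀).2.mono hF.1⟩ (k, x) (hs _ fun i hi =>
            (hG i i₀ hi).trans hF)).1
        have hkj : k = j ∨ k = j + 1 := by
          have h₁ : (j : ℕ) ≤ k := by
            by_contra! h
            exact (hbelow ⟨k, h.trans j.2⟩ h).false
          have h₂ : k ≤ j + 1 := by
            by_contra! h
            exact habove ⟨j + 1, h.trans_le hkm⟩ (Nat.lt_succ_self j) h
          omega
        refine ⟨extendState (k, x) j (α j (G i₀) + pfSum (H j (G i₀)) (f i₀)), fun F hF => ?_,
          fun j' => ?_⟩
        · exact (hSext (G i₀) F (hF i₀ (Nat.lt_succ_self l)) (k, x)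
            (hs _ fun i hi => hG i i₀ hi)).2 j _ (hf i₀) hkj
        · dsimp only [extendState]
          obtain rfl | hj' := eq_or_ne j' j
          · refine ⟨iff_of_true (Nat.lt_succ_self _) ⟨i₀, hj, Nat.lt_succ_self l⟩, fun _ => ?_⟩
            have hins : ((β j').1.filter fun i : Fin n => (i : ℕ) < l + 1) =
                insert i₀ ((β j').1.filter fun i : Fin n => (i : ℕ) < l) := by
              ext i
              simp only [Finset.mem_filter, Finset.mem_insert, Fin.ext_iff, Nat.lt_succ_iff_lt_or_eq,
                i₀]
              constructor
              · rintro ⟨h, h' | h'⟩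
                · exact Or.inr ⟨h, h'⟩
                · exact Or.inl h'
              · rintro (h | ⟨h, h'⟩)
                · exact ⟨by rwa [show i = i₀ from Fin.ext h], Or.inr h⟩
                · exact ⟨h, Or.inl h'⟩
            rw [hins, Finset.sum_insert (by simp [i₀]), Function.update_self]
            -- Either block `j'` opens at `i₀`, with no earlier terms, or it is the current block
            -- and grows.
            obtain rfl | rfl := hkj
            · rw [if_pos rfl, Finset.sum_eq_zero, add_zero]
              intro i hi
              rw [Finset.mem_filter] at hi
              exact ((hk j').1.2 ⟨i, hi⟩).false.elim
            · rw [if_neg (Nat.succ_ne_self _), PNat.add_coe, (hk j').2 (Nat.lt_succ_self _),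
                add_comm]
          · have hv : (j' : ℕ) ≠ j := fun h => hj' (Fin.ext h)
            rw [(hstay j' (hnot j' hj')).1, (hstay j' (hnot j' hj')).2, Function.update_of_ne hv,
              ← (hk j').1]
            have hiff : (j' : ℕ) < j + 1 ↔ (j' : ℕ) < k := by omega
            exact ⟨hiff, fun h => (hk j').2 (hiff.1 h)⟩
      · push Not at hex
        refine ⟨(k, x), fun F hF => hs F fun i hi => hF i (hi.trans l.lt_succ_self), fun j => ?_⟩
        rw [(hstay j (hex j)).1, (hstay j (hex j)).2]
        exact hk j
  obtain ⟨⟨k, x⟩, hs, hk⟩ := key n le_rfl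
  dsimp only at hk
  -- `S F` only holds states built strictly below `F`, so the final state is read off above the
  -- whole chain.
  obtain ⟨F, hF⟩ : ∃ F : Pf (ℕ+ → ℕ+), ∀ i, (G i).1 ⊂ F.1 := by
    classical
    obtain ⟨F, hF⟩ := exists_ssubset (insert (fun _ => 1) (Finset.univ.biUnion fun i => (G i).1))
    exact ⟨⟨F, (Finset.insert_nonempty _ _).mono hF.1⟩, fun i =>
      ((Finset.subset_biUnion_of_mem (fun i => (G i).1) (Finset.mem_univ i)).trans
        (Finset.subset_insert _ _)).trans_ssubset hF⟩
  have hadm := hS F (k, x) (hs F fun i _ => hF i)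
  have hlt : ∀ j : Fin m, (j : ℕ) < k := fun j => by
    obtain ⟨i, hi⟩ := (β j).2
    exact (hk j).1.2 ⟨i, hi, i.2⟩
  obtain rfl : k = m := by
    refine le_antisymm hadm.1 ?_
    by_contra! h
    exact (hlt ⟨k, h⟩).false
  convert hLA x hadm.2.1 using 1
  funext j
  apply PNat.coe_injective
  rw [(hk j).2 (hlt j), coe_pfSum, Finset.filter_true_of_mem fun i _ => i.2]

end CentralSets

theorem theorem1p18 (m : ℕ) (hm : 1 ≤ m) (A : Set (Fin m → ℕ+)) :
    (∃ (α : Fin m → Pf (ℕ+ → ℕ+) → ℕ+) (H : Fin m → Pf (ℕ+ → ℕ+) → Pf ℕ+),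
      (∀ F G : Pf (ℕ+ → ℕ+), F.1 ⊂ G.1 → ∀ j : Fin m, Before (H j F) (H j G)) ∧
      (∀ n : ℕ, m ≤ n →
        ∀ G : Fin n → Pf (ℕ+ → ℕ+), (∀ i i' : Fin n, i < i' → (G i).1 ⊂ (G i').1) →
        ∀ β : Fin m → Pf (Fin n), (∀ j j' : Fin m, j < j' → Before (β j) (β j')) →
        ∀ f : Fin n → (ℕ+ → ℕ+), (∀ i : Fin n, f i ∈ (G i).1) →
          (fun j : Fin m => pfSum (β j) fun i => α j (G i) + pfSum (H j (G i)) (f i)) ∈ A)) ↔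
    (∃ p : Fin m → Ultrafilter ℕ+,
      (∀ j : Fin m, p j ∈ J ∧ p j + p j = p j) ∧ A ∈ tensor m p) := by
  constructor
  · rintro ⟨α, H, -, hA⟩
    exact exists_tensor_of_chains α H hA
  · rintro ⟨p, hp, hA⟩
    exact exists_chains_of_tensor hp hA
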